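/- Let $Y$ be a separable real Banach space and let $X=Y^*$; write $X_{w*}$ for $X$ with the weak-$*$ topology and its Borel $\sigma$-algebra. Let $\{y_j : j\in\mathbb N\}\subset Y$ be a countable set separating the points of $X$. Let $\psi\colon X\to(0,\infty)$ be an admissible weight function, i.e. $K_R=\{x\in X:\psi(x)\le R\}$ is weak-$*$ compact for every $R>0$. Let $\mathrm B^\psi(X_{w*})$ be the space of all $f\colon X\to\mathbb R$ with $\lVert f\rVert_\psi:=\sup_{x\in X}\psi(x)^{-1}\lvert f(x)\rvert<\infty$, normed by $\lVert\cdot\rVert_\psi$, and let $\mathcal B^\psi(X_{w*})$ be the closure in it of the space $\mathrm C_b(X_{w*})$ of bounded weak-$*$ continuous functions. Let $(\Omega,\mathcal F,\mathbb P,(\mathcal F_t)_{t\ge0})$ be a filtered probability space satisfying the usual conditions and let $(x(t,x_0))_{t\ge0}$, $x_0\in X$, be a time-homogeneous Markov process on it with values in $X$, started at $x_0$: each $x(t,x_0)$ is $\mathcal F_t$-measurable, $x(0,x_0)=x_0$ almost surely, and $p_t(x_0,A):=\mathbb P[x(t,x_0)\in A]$ is measurable in $x_0$ and satisfies $\mathbb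 P[x(s+t,x_0)\in A\mid\mathcal F_s]=p_t(x(s,x_0),A)$ almost surely for all $s,t\ge0$, $x_0\in X$ and Borel sets $A$. Assume that for every $x_0\in X$ almost every trajectory $t\mapsto x(t,x_0)$ is weak-$*$ right-continuous on $[0,\infty)$. Assume that there are $C\in\mathbb R$ and $\varepsilon>0$ with $$\mathbb E[\psi(x(t,x_0))]\le C\psi(x_0)\quad\text{for all }x_0\in X,\ t\in[0,\varepsilon],$$ and that for every $t>0$, every $j\in\mathbb N$ and every sequence $(x_n)_{n\in\mathbb N}$ in $X$ converging weak-$*$ to some $x_0\in X$, $$\lim_{n\to\infty}\langle x(t,x_n),y_j\rangle=\langle x(t,x_0),y_j\rangle\quad\text{almost surely.}$$ Then for all $f\in\mathcal B^\psi(X_{w*})$, $t\ge0$ and $x_0\in X$ the random variable $f(x(t,x_0))$ is integrable, and $P_tf(x_0):=\mathbb E[f(x(t,x_0))]$ defines a family of bounded linear operators $P_t\colon\mathcal B^\psi(X_{w*})\to\mathcal B^\psi(X_{w*})$, $t\ge0$, that is a generalised Feller semigroup, that is: (F1) $P_0=I$; (F2) $P_{t+s}=P_tP_s$ for all $t,s\ge0$;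 (F3) $\lim_{t\to0+}P_tf(x)=f(x)$ for all $f\in\mathcal B^\psi(X_{w*})$ and $x\in X$; (F4) there are $C'\in\mathbb R$ and $\varepsilon'>0$ with $\lVert P_t\rVert\le C'$ for all $t\in[0,\varepsilon']$; (F5) $P_tf\ge0$ whenever $f\ge0$. Moreover it is strongly continuous: $\lim_{t\to0+}\lVert P_tf-f\rVert_\psi=0$ for all $f\in\mathcal B^\psi(X_{w*})$. -/

import Mathlib

open MeasureTheory ProbabilityTheory Filter Topology
open scoped NNReal ENNReal

/-- An admissible weight function on a topological space `X` (the intended spaces are completely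
regular Hausdorff): a function `ψ : X → (0, ∞)` whose sublevel sets `K_R = {x | ψ x ≤ R}` are
compact for all `R > 0`. -/
structure AdmissibleWeight (X : Type*) [TopologicalSpace X] where
  /-- the underlying function -/
  toFun : X → ℝ
  pos : ∀ x, 0 < toFun x
  isCompact_sublevel : ∀ R : ℝ, 0 < R → IsCompact {x | toFun x ≤ R}

instance {X : Type*} [TopologicalSpace X] : CoeFun (AdmissibleWeight X) (fun _ => X → ℝ) :=
  ⟨AdmissibleWeight.toFun⟩

section Spaces

variable {X : Type*} [TopologicalSpace X]

/-- The real vector space of all functions `f : X → ℝ` with `sup_x ψ(x)⁻¹ |f x| < ∞`. -/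
def weightedBoundedSubmodule (ψ : AdmissibleWeight X) : Submodule ℝ (X → ℝ) where
  carrier := {f | BddAbove (Set.range fun x => (ψ x)⁻¹ * |f x|)}
  zero_mem' := ⟨0, by rintro _ ⟨x, rfl⟩; simp⟩
  add_mem' := by
    rintro f g ⟨a, ha⟩ ⟨b, hb⟩
    refine ⟨a + b, ?_⟩
    rintro _ ⟨x, rfl⟩
    have h1 := ha ⟨x, rfl⟩
    have h2 := hb ⟨x, rfl⟩
    have h3 : (ψ x)⁻¹ * |f x + g x| ≤ (ψ x)⁻¹ * (|f x| + |g x|) :=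
      mul_le_mul_of_nonneg_left (abs_add_le _ _) (inv_nonneg.2 (ψ.pos x).le)
    simp only [Pi.add_apply] at *
    linarith
  smul_mem' := by
    rintro c f ⟨a, ha⟩
    refine ⟨|c| * a, ?_⟩
    rintro _ ⟨x, rfl⟩
    have h1 := mul_le_mul_of_nonneg_left (ha ⟨x, rfl⟩) (abs_nonneg c)
    simp only [Pi.smul_apply, smul_eq_mul, abs_mul] at *
    linarith

/-- The space `B^ψ(X)` of all `f : X → ℝ` with `sup_x ψ(x)⁻¹ |f x| < ∞`, as a type of its own; it
carries the topology of the weighted supremum norm (not that of pointwise convergence). -/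
def WeightedBounded (ψ : AdmissibleWeight X) : Type _ := ↥(weightedBoundedSubmodule ψ)

namespace WeightedBounded

variable {ψ : AdmissibleWeight X}

noncomputable instance : AddCommGroup (WeightedBounded ψ) :=
  inferInstanceAs (AddCommGroup ↥(weightedBoundedSubmodule ψ))

noncomputable instance : Module ℝ (WeightedBounded ψ) :=
  inferInstanceAs (Module ℝ ↥(weightedBoundedSubmodule ψ))

instance : CoeFun (WeightedBounded ψ) (fun _ => X → ℝ) := ⟨Subtype.val⟩

/-- `‖f‖_ψ = sup_x ψ(x)⁻¹ |f x|`. -/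
noncomputable instance : Norm (WeightedBounded ψ) := ⟨fun f => ⨆ x, (ψ x)⁻¹ * |f x|⟩

theorem norm_def (f : WeightedBounded ψ) : ‖f‖ = ⨆ x, (ψ x)⁻¹ * |f x| := rfl

@[simp] theorem add_apply (f g : WeightedBounded ψ) (x : X) : (f + g) x = f x + g x := rfl

@[simp] theorem smul_apply (c : ℝ) (f : WeightedBounded ψ) (x : X) : (c • f) x = c * f x := rfl

@[simp] theorem zero_apply (x : X) : (0 : WeightedBounded ψ) x = 0 := rfl

theorem le_norm (f : WeightedBounded ψ) (x : X) : (ψ x)⁻¹ * |f x| ≤ ‖f‖ :=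
  le_ciSup f.2 x

theorem normCore (ψ : AdmissibleWeight X) : NormedSpace.Core ℝ (WeightedBounded ψ) where
  norm_nonneg f := Real.iSup_nonneg fun x => mul_nonneg (inv_nonneg.2 (ψ.pos x).le) (abs_nonneg _)
  norm_smul c f := by
    simp only [norm_def, smul_apply, abs_mul, Real.norm_eq_abs]
    rw [Real.mul_iSup_of_nonneg (abs_nonneg c)]
    congr 1
    ext x
    ring
  norm_triangle f g := by
    refine Real.iSup_le (fun x => ?_) (add_nonneg
      (Real.iSup_nonneg fun x => mul_nonneg (inv_nonneg.2 (ψ.pos x).le) (abs_nonneg _))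
      (Real.iSup_nonneg fun x => mul_nonneg (inv_nonneg.2 (ψ.pos x).le) (abs_nonneg _)))
    have h1 := le_norm f x
    have h2 := le_norm g x
    have h3 : (ψ x)⁻¹ * |f x + g x| ≤ (ψ x)⁻¹ * (|f x| + |g x|) :=
      mul_le_mul_of_nonneg_left (abs_add_le _ _) (inv_nonneg.2 (ψ.pos x).le)
    rw [add_apply]
    linarith
  norm_eq_zero_iff f := by
    constructor
    · intro h
      refine Subtype.ext (funext fun x => ?_)
      have h1 := le_norm f x
      rw [h] at h1
      have h2 : |f x| ≤ 0 := by
        by_contra hc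
        exact absurd h1 (not_le.2 (mul_pos (inv_pos.2 (ψ.pos x)) (not_le.1 hc)))
      exact abs_nonpos_iff.1 h2
    · rintro rfl
      simp [norm_def]

noncomputable instance : NormedAddCommGroup (WeightedBounded ψ) :=
  NormedAddCommGroup.ofCore (normCore ψ)

noncomputable instance : NormedSpace ℝ (WeightedBounded ψ) :=
  NormedSpace.ofCore (normCore ψ)

end WeightedBounded

/-- The subspace `C_b(X)` of bounded continuous functions inside `B^ψ(X)`. -/
def boundedContinuousSubmodule (ψ : AdmissibleWeight X) : Submodule ℝ (WeightedBounded ψ) where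
  carrier := {f | Continuous (f : X → ℝ) ∧ ∃ C : ℝ, ∀ x, |f x| ≤ C}
  zero_mem' := ⟨continuous_const, 0, fun x => by simp⟩
  add_mem' := by
    rintro f g ⟨hf, a, ha⟩ ⟨hg, b, hb⟩
    refine ⟨hf.add hg, a + b, fun x => ?_⟩
    exact (abs_add_le _ _).trans (add_le_add (ha x) (hb x))
  smul_mem' := by
    rintro c f ⟨hf, a, ha⟩
    refine ⟨hf.const_smul c, |c| * a, fun x => ?_⟩
    rw [WeightedBounded.smul_apply, abs_mul]
    exact mul_le_mul_of_nonneg_left (ha x) (abs_nonneg c)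

/-- The space `𝓑^ψ(X)` of functions with growth controlled by `ψ`: the closure of `C_b(X)` in
`B^ψ(X)` with respect to the norm `‖·‖_ψ`. It inherits the norm `‖·‖_ψ`. -/
abbrev GrowthControlled (ψ : AdmissibleWeight X) : Type _ :=
  ↥(boundedContinuousSubmodule ψ).topologicalClosure

instance (ψ : AdmissibleWeight X) : CoeFun (GrowthControlled ψ) (fun _ => X → ℝ) :=
  ⟨fun f => (f : WeightedBounded ψ)⟩

/-- A generalised Feller semigroup: a family of bounded linear operators on `𝓑^ψ(X)` with the
following five properties. -/
structure IsGeneralisedFellerSemigroup {ψ : AdmissibleWeight X}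
    (T : ℝ≥0 → (GrowthControlled ψ →L[ℝ] GrowthControlled ψ)) : Prop where
  zero : T 0 = ContinuousLinearMap.id ℝ (GrowthControlled ψ)
  add : ∀ t s : ℝ≥0, T (t + s) = (T t).comp (T s)
  pointwise : ∀ (f : GrowthControlled ψ) (x : X), Tendsto (fun t => T t f x) (𝓝[>] 0) (𝓝 (f x))
  bounded : ∃ C : ℝ, ∃ ε : ℝ≥0, 0 < ε ∧ ∀ t ≤ ε, ‖T t‖ ≤ C
  positive : ∀ (t : ℝ≥0) (f : GrowthControlled ψ), (∀ x, 0 ≤ f x) → ∀ x, 0 ≤ T t f x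

end Spaces

section Processes

variable {Ω : Type*} {m : MeasurableSpace Ω}

/-- The usual conditions for a filtered probability space: the filtration is right-continuous and
`𝓕 0` contains every subset of an event of probability zero (so that in particular the probability
space is complete; `P N` is the outer measure of an arbitrary set `N`). -/
structure UsualConditions (𝓕 : Filtration ℝ≥0 m) (P : Measure Ω) : Prop where
  rightContinuous : 𝓕.IsRightContinuous
  null_mem : ∀ N : Set Ω, P N = 0 → MeasurableSet[𝓕 0] N

/-- `x t x₀` (`t ≥ 0`, `x₀ ∈ X`) is a time homogeneous Markov process with values in the measurable
space `X`, started at `x₀`: it is adapted, it starts at `x₀`, and `p_t(x₀, A) = P(x(t,x₀) ∈ A)` is a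
transition function, that is, measurable in `x₀` and such that
`P(x(s+t,x₀) ∈ A | 𝓕 s) = p_t(x(s,x₀), A)` almost surely. -/
structure IsTimeHomogeneousMarkov {X : Type*} [MeasurableSpace X] (𝓕 : Filtration ℝ≥0 m)
    (P : Measure Ω) (x : ℝ≥0 → X → Ω → X) : Prop where
  adapted : ∀ (x₀ : X) (t : ℝ≥0), Measurable[𝓕 t] (x t x₀)
  start : ∀ x₀ : X, ∀ᵐ ω ∂P, x 0 x₀ ω = x₀
  measurable_transition : ∀ (t : ℝ≥0) (A : Set X), MeasurableSet A →
    Measurable fun x₀ => P {ω | x t x₀ ω ∈ A}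
  markov : ∀ (x₀ : X) (s t : ℝ≥0) (A : Set X), MeasurableSet A →
    P⟦{ω | x (s + t) x₀ ω ∈ A} | 𝓕 s⟧ =ᵐ[P] fun ω => P.real {ω' | x t (x s x₀ ω) ω' ∈ A}

end Processes

/-! ### Weighted spaces and density of cylinder functions. -/

section Weight

variable {X : Type*} [TopologicalSpace X]

namespace AdmissibleWeight

variable (ψ : AdmissibleWeight X)

/-! The separating sequence gives a continuous injection `ι` of the state space into `ℕ → ℝ`. On
each compact sublevel set `K_R` it is an embedding, so `K_R` is metrizable and, by Tietze,
continuous functions on `K_R` extend to cylinder functions `G ∘ ι` with the same bound. Off `K_R`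
the weight is large and absorbs bounded errors. Hence bounded cylinder functions are dense in `𝓑^ψ`,
and a bounded function belongs to `𝓑^ψ` as soon as it is continuous on every `K_R`
(`exists_cylinder_approx`).

The laws of the process form a semigroup of Markov kernels. Dominated convergence makes `P_t (G ∘
ι)` sequentially continuous, hence continuous on each `K_R`; with the moment bound and density,
`P_t` preserves `𝓑^ψ` (`exists_operator`).

Strong continuity is where right-continuity of the paths enters. The average of `P_s (G ∘ ι)` over
`s ∈ [0, h]` moves under `P_t` by `O(t / h)`, so it is a strongly continuous vector
(`exists_average`). As `h → 0` these averages converge to `G ∘ ι` only boundedly and pointwise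
(`tendsto_average`), but a Mazur argument (`exists_uniform_approx_of_pointwise`) yields convex
combinations uniformly close on `K_R`; the weight again handles the complement. Strongly continuous
vectors are therefore dense, and local boundedness of `‖P_t‖` extends the convergence to all of
`𝓑^ψ`; (F3) is then a consequence. -/

theorem isClosed_sublevel [T2Space X] (R : ℝ) : IsClosed {x | ψ x ≤ R} := by
  rcases lt_or_ge 0 R with h | h
  · exact (ψ.isCompact_sublevel R h).isClosed
  · convert isClosed_empty
    ext x
    simpa using h.trans_lt (ψ.pos x)

theorem measurable [T2Space X] [MeasurableSpace X] [BorelSpace X] : Measurable (ψ : X → ℝ) :=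
  measurable_of_Iic fun R => (ψ.isClosed_sublevel R).measurableSet

/-- An admissible weight is bounded away from zero. -/
theorem exists_pos_le [T2Space X] : ∃ δ : ℝ, 0 < δ ∧ ∀ x, δ ≤ ψ x := by
  by_contra! H
  have hpos : ∀ n : ℕ, (0 : ℝ) < 1 / ((n : ℝ) + 1) := fun n => Nat.one_div_pos_of_nat
  -- If `ψ` had infimum zero, these nested compact sets would be nonempty, and a common point would
  -- have weight at most `0`.
  obtain ⟨x, hx⟩ := IsCompact.nonempty_iInter_of_sequence_nonempty_isCompact_isClosed
    (fun n : ℕ => {x | ψ x ≤ 1 / ((n : ℝ) + 1)})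
    (fun n x hx => le_trans (α := ℝ) hx
      (Nat.one_div_le_one_div (by omega)))
    (fun n => (H _ (hpos n)).imp fun x hx => hx.le)
    (ψ.isCompact_sublevel _ (hpos 0)) (fun n => ψ.isClosed_sublevel _)
  obtain ⟨n, hn⟩ := exists_nat_one_div_lt (ψ.pos x)
  exact absurd (Set.mem_iInter.1 hx n) (not_le.2 hn)

end AdmissibleWeight

variable {ψ : AdmissibleWeight X}

namespace WeightedBounded

theorem abs_apply_le (f : WeightedBounded ψ) (x : X) : |f x| ≤ ‖f‖ * ψ x := by
  have := f.le_norm x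
  rwa [inv_mul_le_iff₀ (ψ.pos x), mul_comm] at this

theorem norm_le {f : WeightedBounded ψ} {c : ℝ} (hc : 0 ≤ c) (h : ∀ x, |f x| ≤ c * ψ x) :
    ‖f‖ ≤ c :=
  Real.iSup_le (fun x => by rw [inv_mul_le_iff₀ (ψ.pos x), mul_comm]; exact h x) hc

@[simp] theorem sub_apply (f g : WeightedBounded ψ) (x : X) : (f - g) x = f x - g x := rfl

/-- A function dominated by a multiple of `ψ`, as an element of `B^ψ`. -/
def ofBound (ψ : AdmissibleWeight X) (f : X → ℝ) (c : ℝ) (h : ∀ x, |f x| ≤ c * ψ x) :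
    WeightedBounded ψ :=
  ⟨f, c, by
    rintro _ ⟨x, rfl⟩
    simp only
    rw [inv_mul_le_iff₀ (ψ.pos x), mul_comm]
    exact h x⟩

@[simp] theorem ofBound_apply (f : X → ℝ) (c : ℝ) (h : ∀ x, |f x| ≤ c * ψ x) (x : X) :
    ofBound ψ f c h x = f x := rfl

end WeightedBounded

/-- A continuous function on a compact set factors through a continuous injection into `ℝ^ℕ`. -/
theorem exists_cylinder_eqOn {ι : X → ℕ → ℝ} (hι : Continuous ι) (hinj : Function.Injective ι)
    {K : Set X} (hK : IsCompact K) {h : X → ℝ} (hh : ContinuousOn h K) {M : ℝ} (hM0 : 0 ≤ M)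
    (hM : ∀ x ∈ K, |h x| ≤ M) :
    ∃ G : C(ℕ → ℝ, ℝ), (∀ z, |G z| ≤ M) ∧ ∀ x ∈ K, G (ι x) = h x := by
  have := isCompact_iff_compactSpace.1 hK
  have he : IsClosedEmbedding (fun x : K => ι x) :=
    (hι.comp continuous_subtype_val).isClosedEmbedding (hinj.comp Subtype.val_injective)
  obtain ⟨G, hG, hGe⟩ :=
    BoundedContinuousFunction.exists_extension_forall_mem_Icc_of_isClosedEmbedding
      (BoundedContinuousFunction.mkOfCompact ⟨K.domRestrict h, hh.domRestrict⟩) (a := -M) (b := M)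
      (fun x => abs_le.1 (hM x x.2)) (by linarith) he
  exact ⟨G.toContinuousMap, fun z => abs_le.2 (hG z), fun x hx => congrFun hGe ⟨x, hx⟩⟩

/-- On a compact set that injects continuously into `ℝ^ℕ`, sequential continuity suffices. -/
theorem continuousOn_of_seq {ι : X → ℕ → ℝ} (hι : Continuous ι) (hinj : Function.Injective ι)
    {K : Set X} (hK : IsCompact K) {h : X → ℝ}
    (hh : ∀ (u : ℕ → X) (x : X), Tendsto u atTop (𝓝 x) →
      Tendsto (fun n => h (u n)) atTop (𝓝 (h x))) : ContinuousOn h K := by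
  have := isCompact_iff_compactSpace.1 hK
  have he : IsClosedEmbedding (fun x : K => ι x) :=
    (hι.comp continuous_subtype_val).isClosedEmbedding (hinj.comp Subtype.val_injective)
  have := he.isEmbedding.metrizableSpace
  rw [continuousOn_iff_continuous_domRestrict]
  refine SeqContinuous.continuous fun u x hu => ?_
  exact hh _ _ ((continuous_subtype_val.tendsto x).comp hu)

/-- A bounded function that is continuous on the sublevel sets of `ψ` is a limit of cylinder
functions in the weighted norm. -/
theorem exists_cylinder_approx {ι : X → ℕ → ℝ} (hι : Continuous ι) (hinj : Function.Injective ι)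
    {h : X → ℝ} (hh : ∀ R : ℝ, 0 < R → ContinuousOn h {x | ψ x ≤ R}) {M : ℝ}
    (hM : ∀ x, |h x| ≤ M) {η : ℝ} (hη : 0 < η) :
    ∃ G : C(ℕ → ℝ, ℝ), (∃ M, ∀ z, |G z| ≤ M) ∧ ∀ x, |h x - G (ι x)| ≤ η * ψ x := by
  set B := max M 0
  have hB0 : 0 ≤ B := le_max_right _ _
  -- The radius is chosen so that off the sublevel set `η * ψ x` exceeds `2 * B`, which bounds the
  -- error there.
  have hR : 0 < 2 * B / η + 1 := by positivity
  obtain ⟨G, hG, hGe⟩ := exists_cylinder_eqOn hι hinj (ψ.isCompact_sublevel _ hR) (hh _ hR) hB0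
    fun x _ => (hM x).trans (le_max_left _ _)
  refine ⟨G, ⟨B, hG⟩, fun x => ?_⟩
  by_cases hx : ψ x ≤ 2 * B / η + 1
  · rw [hGe x hx, sub_self, abs_zero]
    exact mul_nonneg hη.le (ψ.pos x).le
  · have h1 : 2 * B / η * η = 2 * B := div_mul_cancel₀ _ hη.ne'
    have h2 := abs_sub (h x) (G (ι x))
    have h3 := hG (ι x)
    have h4 : |h x| ≤ B := (hM x).trans (le_max_left _ _)
    nlinarith [not_le.1 hx]

theorem GrowthControlled.measurable [MeasurableSpace X] [BorelSpace X] (f : GrowthControlled ψ) :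
    Measurable (f : X → ℝ) := by
  obtain ⟨g, hg, hgf⟩ := mem_closure_iff_seq_limit.1 f.2
  refine measurable_of_tendsto_metrizable (f := fun n => (g n : X → ℝ))
    (fun n => (hg n).1.measurable) (tendsto_pi_nhds.2 fun x => ?_)
  rw [tendsto_iff_norm_sub_tendsto_zero] at hgf ⊢
  have h0 := hgf.mul_const (ψ x)
  rw [zero_mul] at h0
  exact squeeze_zero (fun n => norm_nonneg _)
    (fun n => (g n - (f : WeightedBounded ψ)).abs_apply_le x) h0

theorem GrowthControlled.exists_cylinder {ι : X → ℕ → ℝ} (hι : Continuous ι)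
    (hinj : Function.Injective ι)
    (f : GrowthControlled ψ) {η : ℝ} (hη : 0 < η) :
    ∃ G : C(ℕ → ℝ, ℝ), (∃ M, ∀ z, |G z| ≤ M) ∧ ∀ x, |f x - G (ι x)| ≤ η * ψ x := by
  obtain ⟨g, hg, hfg⟩ := Metric.mem_closure_iff.1 f.2 (η / 2) (half_pos hη)
  obtain ⟨hgc, M, hM⟩ := hg
  obtain ⟨G, hG, hGe⟩ := exists_cylinder_approx (ψ := ψ) hι hinj
    (fun R _ => hgc.continuousOn) hM (half_pos hη)
  refine ⟨G, hG, fun x => ?_⟩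
  rw [dist_eq_norm] at hfg
  have h1 := ((f : WeightedBounded ψ) - g).abs_apply_le x
  rw [WeightedBounded.sub_apply] at h1
  have h2 := mul_le_mul_of_nonneg_right hfg.le (ψ.pos x).le
  have h3 := abs_sub_le (f x) (g x) (G (ι x))
  linarith [hGe x]

theorem GrowthControlled.abs_apply_le (f : GrowthControlled ψ) (x : X) : |f x| ≤ ‖f‖ * ψ x :=
  WeightedBounded.abs_apply_le (f : WeightedBounded ψ) x

theorem GrowthControlled.norm_le {f : GrowthControlled ψ} {c : ℝ} (hc : 0 ≤ c)
    (h : ∀ x, |f x| ≤ c * ψ x) :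
    ‖f‖ ≤ c :=
  WeightedBounded.norm_le hc h

variable [T2Space X]

/-- A bounded function is dominated by a multiple of `ψ`. -/
theorem exists_le_mul_weight (ψ : AdmissibleWeight X) (M : ℝ) :
    ∃ c : ℝ, 0 ≤ c ∧ ∀ x, M ≤ c * ψ x := by
  obtain ⟨δ, hδ, h⟩ := ψ.exists_pos_le
  refine ⟨|M| / δ, by positivity, fun x => ?_⟩
  calc M ≤ |M| / δ * δ := by rw [div_mul_cancel₀ _ hδ.ne']; exact le_abs_self M
    _ ≤ _ := mul_le_mul_of_nonneg_left (h x) (by positivity)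

namespace GrowthControlled

theorem mem_of_approx {ι : X → ℕ → ℝ} (hι : Continuous ι) {f : WeightedBounded ψ}
    (h : ∀ η : ℝ, 0 < η → ∃ G : C(ℕ → ℝ, ℝ), (∃ M, ∀ z, |G z| ≤ M) ∧
      ∀ x, |f x - G (ι x)| ≤ η * ψ x) :
    f ∈ (boundedContinuousSubmodule ψ).topologicalClosure := by
  refine Metric.mem_closure_iff.2 fun η hη => ?_
  obtain ⟨G, ⟨M, hM⟩, hG⟩ := h (η / 2) (half_pos hη)
  obtain ⟨c, -, hc⟩ := exists_le_mul_weight ψ M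
  refine ⟨.ofBound ψ (fun x => G (ι x)) c fun x => (hM _).trans (hc x),
    ⟨G.continuous.comp hι, M, fun x => hM _⟩, ?_⟩
  rw [dist_eq_norm]
  exact (WeightedBounded.norm_le (half_pos hη).le hG).trans_lt (half_lt_self hη)

/-- A bounded function that is continuous on the sublevel sets of `ψ`, as an element of `𝓑^ψ`. -/
theorem exists_of_bounded {ι : X → ℕ → ℝ} (hι : Continuous ι) (hinj : Function.Injective ι)
    {h : X → ℝ} (hh : ∀ R : ℝ, 0 < R → ContinuousOn h {x | ψ x ≤ R}) {M : ℝ}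
    (hM : ∀ x, |h x| ≤ M) : ∃ f : GrowthControlled ψ, ∀ x, f x = h x := by
  obtain ⟨c, -, hc⟩ := exists_le_mul_weight ψ M
  exact ⟨⟨.ofBound ψ h c fun x => (hM _).trans (hc x),
    mem_of_approx hι fun η hη => exists_cylinder_approx hι hinj hh hM hη⟩, fun x => rfl⟩

end GrowthControlled

end Weight

/-! ### Joint measurability in time and space. -/

section Measurability

/-- A function of time and space is jointly measurable if it is right-continuous in time and
measurable in space. -/
theorem measurable_uncurry_of_right_continuous {Z : Type*} [MeasurableSpace Z]
    {F : ℝ≥0 → Z → ℝ} (hmeas : ∀ s, Measurable (F s))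
    (hcont : ∀ z s, ContinuousWithinAt (fun r => F r z) (Set.Ici s) s) :
    Measurable (Function.uncurry F) := by
  -- Grid times with countably many values; adding `1` to the floor makes them approach `s` from the
  -- right.
  let a : ℕ → ℝ≥0 → ℝ≥0 := fun n s => ((⌊((n : ℝ≥0) + 1) * s⌋₊ : ℝ≥0) + 1) / ((n : ℝ≥0) + 1)
  have hn0 : ∀ n : ℕ, (0 : ℝ≥0) < (n : ℝ≥0) + 1 := fun n => by positivity
  have ha1 : ∀ n s, s ≤ a n s := fun n s => by
    rw [le_div_iff₀ (hn0 n), mul_comm]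
    exact (Nat.lt_floor_add_one _).le
  have ha2 : ∀ n s, a n s ≤ s + 1 / ((n : ℝ≥0) + 1) := fun n s => by
    rw [div_le_iff₀ (hn0 n), add_mul s, div_mul_cancel₀ _ (hn0 n).ne', mul_comm s]
    exact add_le_add_left (Nat.floor_le zero_le) _
  refine measurable_of_tendsto_metrizable (f := fun n (p : ℝ≥0 × Z) => F (a n p.1) p.2)
    (fun n => ?_) (tendsto_pi_nhds.2 fun p => ?_)
  · have h1 : ∀ b : ℕ → ℝ≥0, Measurable fun q : ℕ × Z => F (b q.1) q.2 := fun b =>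
      measurable_from_prod_countable_right fun k => hmeas (b k)
    have h2 : Measurable fun p : ℝ≥0 × Z => (⌊((n : ℝ≥0) + 1) * p.1⌋₊, p.2) :=
      (Nat.measurable_floor.comp (measurable_fst.const_mul _)).prodMk measurable_snd
    have h3 := (h1 fun k => ((k : ℝ≥0) + 1) / ((n : ℝ≥0) + 1)).comp h2
    simpa only [Function.comp_def] using h3
  · have hlim : Tendsto (fun n => a n p.1) atTop (𝓝 p.1) := by
      have h0 : Tendsto (fun n : ℕ => p.1 + 1 / ((n : ℝ≥0) + 1)) atTop (𝓝 (p.1 + 0)) :=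
        tendsto_const_nhds.add tendsto_one_div_add_atTop_nhds_zero_nat
      rw [add_zero] at h0
      exact tendsto_of_tendsto_of_tendsto_of_le_of_le tendsto_const_nhds h0 (ha1 · p.1)
        (ha2 · p.1)
    exact (hcont p.2 p.1).tendsto.comp (tendsto_nhdsWithin_iff.2
      ⟨hlim, Eventually.of_forall fun n => ha1 n p.1⟩)

end Measurability

/-! ### From bounded pointwise to uniform approximation by convexity. -/

section Mazur

open CompactlySupported CompactlySupportedContinuousMap in
/-- A positive linear functional on `C(K)`, `K` compact, is given by a finite measure. -/
theorem exists_measure_of_positive {K : Type*} [TopologicalSpace K] [T2Space K] [CompactSpace K]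
    [MeasurableSpace K] [BorelSpace K] (l : C(K, ℝ) →ₗ[ℝ] ℝ) (hl : ∀ w : C(K, ℝ), 0 ≤ w → 0 ≤ l w) :
    ∃ μ : Measure K, IsFiniteMeasure μ ∧ ∀ w : C(K, ℝ), ∫ z, w z ∂μ = l w := by
  let Λ : C_c(K, ℝ) →ₚ[ℝ] ℝ := PositiveLinearMap.mk₀
    { toFun := fun w => l w.toContinuousMap
      map_add' := fun v w => l.map_add _ _
      map_smul' := fun c w => l.map_smul _ _ } (fun w hw => hl _ hw)
  refine ⟨RealRMK.rieszMeasure Λ, ?_, fun w =>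
    RealRMK.integral_rieszMeasure Λ (continuousMapEquiv w)⟩
  exact ⟨isCompact_univ.measure_lt_top⟩

/-- If functions from a convex set converge boundedly pointwise to `f` on a compact space,
then some function in the convex set is uniformly close to `f`. -/
theorem exists_uniform_approx_of_pointwise {K : Type*} [TopologicalSpace K] [T2Space K]
    [CompactSpace K] {S : Set (K → ℝ)} (hS : Convex ℝ S) (hScont : ∀ g ∈ S, Continuous g)
    {g : ℕ → K → ℝ} (hg : ∀ n, g n ∈ S) {M : ℝ} (hM : ∀ n z, |g n z| ≤ M) {f : K → ℝ}
    (hf : Continuous f) (hgf : ∀ z, Tendsto (fun n => g n z) atTop (𝓝 (f z)))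
    {δ : ℝ} (hδ : 0 < δ) : ∃ h ∈ S, ∀ z, |h z - f z| ≤ δ := by
  classical
  by_contra! H
  -- Doubling the space turns `|h - f| < δ` into a one-sided bound on the pair `(h - f, f - h)`. The
  -- separating functional is then positive, hence integration against a finite measure, with no
  -- Jordan decomposition needed.
  let U : Set C(K ⊕ K, ℝ) := {v | ∀ z, v z < δ}
  have hUopen : IsOpen U := by
    have := ContinuousMap.isOpen_setOfPred_mapsTo (X := K ⊕ K) isCompact_univ (isOpen_Iio (a := δ))
    simpa [Set.MapsTo, U] using this
  have hUconv : Convex ℝ U := by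
    intro v hv w hw a b ha hb hab z
    exact convex_Iio δ (hv z) (hw z) ha hb hab
  let V : Set C(K ⊕ K, ℝ) :=
    {v | ∃ h ∈ S, ∀ z, v (Sum.inl z) = h z - f z ∧ v (Sum.inr z) = f z - h z}
  have hVconv : Convex ℝ V := by
    rintro v ⟨h, hh, hv⟩ w ⟨k, hk, hw⟩ a b ha hb hab
    refine ⟨a • h + b • k, hS hh hk ha hb hab, fun z => ?_⟩
    have hb' : b = 1 - a := by linarith
    simp only [ContinuousMap.add_apply, ContinuousMap.smul_apply, smul_eq_mul, Pi.add_apply,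
      Pi.smul_apply, (hv z).1, (hv z).2, (hw z).1, (hw z).2, hb']
    constructor <;> ring
  have hdisj : Disjoint U V := by
    refine Set.disjoint_left.2 fun v hvU hvV => ?_
    obtain ⟨h, hh, hv⟩ := hvV
    obtain ⟨z, hz⟩ := H h hh
    have h1 := hvU (Sum.inl z)
    have h2 := hvU (Sum.inr z)
    rw [(hv z).1] at h1
    rw [(hv z).2] at h2
    exact absurd (abs_lt.2 ⟨by linarith, h1⟩) (not_lt.2 hz.le)
  obtain ⟨l, u, hlU, hlV⟩ := geometric_hahn_banach_open hUconv hUopen hVconv hdisj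
  have hu : 0 < u := by
    have := hlU 0 (fun z => hδ)
    rwa [map_zero] at this
  -- `U` contains every `-n • w` with `w ≥ 0`, while `l` is bounded above by `u` on `U`.
  have hpos : ∀ w : C(K ⊕ K, ℝ), 0 ≤ w → 0 ≤ l w := by
    intro w hw
    by_contra! hneg
    obtain ⟨n, hn⟩ := exists_nat_gt (u / -l w)
    have h1 := hlU (-(n : ℝ) • w) fun z => by
      have : 0 ≤ w z := hw z
      have h2 : 0 ≤ (n : ℝ) * w z := by positivity
      simp only [ContinuousMap.smul_apply, smul_eq_mul, neg_mul]
      linarith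
    rw [map_smul, smul_eq_mul] at h1
    rw [div_lt_iff₀ (neg_pos.2 hneg)] at hn
    linarith
  borelize (K ⊕ K)
  obtain ⟨μ, hμ, hμl⟩ := exists_measure_of_positive (l : C(K ⊕ K, ℝ) →ₗ[ℝ] ℝ) hpos
  let v : ℕ → C(K ⊕ K, ℝ) := fun n =>
    ⟨Sum.elim (fun z => g n z - f z) (fun z => f z - g n z),
      ((hScont _ (hg n)).sub hf).sumElim (hf.sub (hScont _ (hg n)))⟩
  have hvV : ∀ n, v n ∈ V := fun n => ⟨g n, hg n, fun z => ⟨rfl, rfl⟩⟩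
  have hfM : ∀ z, |f z| ≤ M := fun z =>
    le_of_tendsto (hgf z).abs (Eventually.of_forall fun n => hM n z)
  -- Dominated convergence sends these integrals to `0`, although separation keeps them above `u >
  -- 0`.
  have hlim : Tendsto (fun n => ∫ z, v n z ∂μ) atTop (𝓝 (∫ _, (0 : ℝ) ∂μ)) := by
    refine tendsto_integral_of_dominated_convergence (fun _ => 2 * M)
      (fun n => (v n).continuous.aestronglyMeasurable) (integrable_const _)
      (fun n => Eventually.of_forall fun z => ?_) (Eventually.of_forall fun z => ?_)
    · rcases z with z | z
      · have := abs_sub (g n z) (f z)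
        simp only [v, ContinuousMap.coe_mk, Sum.elim_inl, Real.norm_eq_abs]
        linarith [hM n z, hfM z]
      · have := abs_sub (f z) (g n z)
        simp only [v, ContinuousMap.coe_mk, Sum.elim_inr, Real.norm_eq_abs]
        linarith [hM n z, hfM z]
    · rcases z with z | z
      · simpa [v] using (hgf z).sub_const (f z)
      · simpa [v] using (hgf z).const_sub (f z)
  rw [integral_zero] at hlim
  refine absurd (ge_of_tendsto hlim (Eventually.of_forall fun n => ?_)) (not_le.2 hu)
  rw [hμl]
  exact hlV _ (hvV n)

end Mazur

/-! ### Semigroups of Markov kernels acting on the weighted space. -/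

section KernelSemigroup

variable {X : Type*} [TopologicalSpace X] [MeasurableSpace X]

/-- A semigroup of Markov kernels on `X` which is controlled by the weight `ψ` and acts
well on the bounded functions that factor continuously through `ι : X → ℝ^ℕ`. -/
structure IsWeightedFellerKernels (ψ : AdmissibleWeight X) (ι : X → ℕ → ℝ)
    (κ : ℝ≥0 → Kernel X X) : Prop where
  isMarkovKernel : ∀ t, IsMarkovKernel (κ t)
  zero : ∀ x, κ 0 x = Measure.dirac x
  add : ∀ s t, κ (s + t) = κ t ∘ₖ κ s
  moment : ∃ C : ℝ, ∃ ε : ℝ≥0, 0 < ε ∧ ∀ t ≤ ε, ∀ x,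
    ∫⁻ z, ENNReal.ofReal (ψ z) ∂κ t x ≤ ENNReal.ofReal C * ENNReal.ofReal (ψ x)
  tendsto : ∀ G : C(ℕ → ℝ, ℝ), (∃ M, ∀ z, |G z| ≤ M) → ∀ (t : ℝ≥0) (u : ℕ → X) (x : X),
    Tendsto u atTop (𝓝 x) →
      Tendsto (fun n => ∫ z, G (ι z) ∂κ t (u n)) atTop (𝓝 (∫ z, G (ι z) ∂κ t x))
  right_continuous : ∀ G : C(ℕ → ℝ, ℝ), (∃ M, ∀ z, |G z| ≤ M) → ∀ (x : X) (s : ℝ≥0),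
    ContinuousWithinAt (fun t => ∫ z, G (ι z) ∂κ t x) (Set.Ici s) s

theorem abs_integral_le_of_bound {Z : Type*} [MeasurableSpace Z] (μ : Measure Z)
    [IsProbabilityMeasure μ] {f : Z → ℝ} {M : ℝ} (hM : ∀ z, |f z| ≤ M) : |∫ z, f z ∂μ| ≤ M := by
  simpa using norm_integral_le_of_norm_le_const (μ := μ) (f := f) (C := M) (Eventually.of_forall hM)

/-- A shift of a bounded function changes its average little. -/
theorem abs_average_shift_sub_le {Φ : ℝ → ℝ} (hΦ : Measurable Φ) {M : ℝ} (hM : ∀ r, |Φ r| ≤ M)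
    {h t : ℝ} (hh : 0 < h) (ht : 0 ≤ t) :
    |(∫ s in (0 : ℝ)..1, Φ (h * s + t)) - ∫ s in (0 : ℝ)..1, Φ (h * s)| ≤ h⁻¹ * (2 * M) * t := by
  have hint : ∀ a b, IntervalIntegrable Φ volume a b := fun a b =>
    (intervalIntegrable_const (c := M)).mono_fun hΦ.aestronglyMeasurable
      (Eventually.of_forall fun r => (hM r).trans (le_abs_self M))
  have h1 : ∀ a b, a ≤ b → |∫ s in a..b, Φ s| ≤ M * (b - a) := fun a b hab => by
    have := intervalIntegral.norm_integral_le_of_norm_le_const (a := a) (b := b) (f := Φ) (C := M)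
      fun r _ => hM r
    rwa [abs_of_nonneg (sub_nonneg.2 hab)] at this
  rw [intervalIntegral.integral_comp_mul_add Φ hh.ne' t,
    intervalIntegral.integral_comp_mul_left Φ hh.ne', ← smul_sub, smul_eq_mul, abs_mul,
    abs_of_pos (inv_pos.2 hh), mul_assoc]
  refine mul_le_mul_of_nonneg_left ?_ (inv_pos.2 hh).le
  simp only [mul_zero, mul_one, zero_add]
  -- The common part of `[t, h + t]` and `[0, h]` cancels, leaving two integrals over intervals of
  -- length `t`.
  rw [intervalIntegral.integral_interval_sub_interval_comm' (hint _ _) (hint _ _) (hint _ _)]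
  have h2 := h1 h (h + t) (by linarith)
  have h3 := h1 0 t ht
  have h4 := abs_sub (∫ s in h..(h + t), Φ s) (∫ s in (0 : ℝ)..t, Φ s)
  linarith

/-- The set of strongly continuous vectors of a locally bounded family of operators is closed. -/
theorem tendsto_norm_sub_of_approx {E : Type*} [NormedAddCommGroup E] [NormedSpace ℝ E]
    {T : ℝ≥0 → (E →L[ℝ] E)} (hb : ∃ c : ℝ, ∃ ε : ℝ≥0, 0 < ε ∧ ∀ t ≤ ε, ‖T t‖ ≤ c) {f : E}
    (hf : ∀ η : ℝ, 0 < η → ∃ g : E, ‖g - f‖ ≤ η ∧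
      Tendsto (fun t => ‖T t g - g‖) (𝓝[>] 0) (𝓝 0)) :
    Tendsto (fun t => ‖T t f - f‖) (𝓝[>] 0) (𝓝 0) := by
  obtain ⟨c, ε, hε, hc⟩ := hb
  have hc0 : 0 ≤ c := (norm_nonneg _).trans (hc 0 zero_le)
  rw [Metric.tendsto_nhds]
  intro η hη
  obtain ⟨g, hgf, hg⟩ := hf (η / (2 * (c + 1))) (by positivity)
  have h1 : Set.Iic ε ∈ 𝓝[>] (0 : ℝ≥0) := mem_nhdsWithin_of_mem_nhds (Iic_mem_nhds hε)
  filter_upwards [h1, Metric.tendsto_nhds.1 hg (η / 2) (half_pos hη)] with t ht htg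
  rw [dist_zero_right, norm_norm] at htg ⊢
  have h2 : T t f - f = (T t g - g) - (T t (g - f) - (g - f)) := by
    rw [map_sub]; abel
  have h3 : ‖T t (g - f)‖ ≤ c * ‖g - f‖ := (T t).le_of_opNorm_le (hc t ht) _
  have h4 : (c + 1) * ‖g - f‖ ≤ η / 2 := by
    calc (c + 1) * ‖g - f‖ ≤ (c + 1) * (η / (2 * (c + 1))) := by gcongr
      _ = η / 2 := by field_simp
  calc ‖T t f - f‖ ≤ ‖T t g - g‖ + (‖T t (g - f)‖ + ‖g - f‖) := by
        rw [h2]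
        exact (norm_sub_le _ _).trans (add_le_add_right (norm_sub_le _ _) _)
    _ < η := by linarith

namespace IsWeightedFellerKernels

variable [BorelSpace X] {ψ : AdmissibleWeight X} {ι : X → ℕ → ℝ}
  {κ : ℝ≥0 → Kernel X X}

theorem integrable_cylinder (hκ : IsWeightedFellerKernels ψ ι κ) (hι : Continuous ι)
    {G : C(ℕ → ℝ, ℝ)} {M : ℝ} (hM : ∀ z, |G z| ≤ M) (t : ℝ≥0) (x : X) :
    Integrable (fun z => G (ι z)) (κ t x) :=
  have := hκ.isMarkovKernel t
  .of_bound (G.continuous.comp hι).measurable.aestronglyMeasurable M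
    (Eventually.of_forall fun _ => hM _)

theorem measurable_integral_cylinder (hκ : IsWeightedFellerKernels ψ ι κ) (hι : Continuous ι)
    {G : C(ℕ → ℝ, ℝ)} {M : ℝ} (hM : ∀ z, |G z| ≤ M) :
    Measurable (Function.uncurry fun s x => ∫ z, G (ι z) ∂κ s x) :=
  have := hκ.isMarkovKernel
  measurable_uncurry_of_right_continuous
    (fun s => ((G.continuous.comp hι).measurable.stronglyMeasurable.integral_kernel
      (κ := κ s)).measurable)
    (fun x s => hκ.right_continuous G ⟨M, hM⟩ x s)

theorem tendsto_average (hκ : IsWeightedFellerKernels ψ ι κ) (hι : Continuous ι)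
    {G : C(ℕ → ℝ, ℝ)} {M : ℝ} (hM : ∀ z, |G z| ≤ M) (x : X) :
    Tendsto (fun n : ℕ => ∫ s in (0 : ℝ)..1, ∫ z, G (ι z) ∂κ (1 / ((n : ℝ) + 1) * s).toNNReal x)
      atTop (𝓝 (G (ι x))) := by
  have hmk := hκ.isMarkovKernel
  have hFm := hκ.measurable_integral_cylinder hι hM
  have h0 : ∫ z, G (ι z) ∂κ 0 x = G (ι x) := by
    rw [hκ.zero]
    exact integral_dirac' _ _ (G.continuous.comp hι).measurable.stronglyMeasurable
  have h1 : ∫ _ in (0 : ℝ)..1, G (ι x) = G (ι x) := by simp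
  have h2 := intervalIntegral.tendsto_integral_filter_of_dominated_convergence (a := 0) (b := 1)
    (l := atTop) (F := fun (n : ℕ) s => ∫ z, G (ι z) ∂κ (1 / ((n : ℝ) + 1) * s).toNNReal x)
    (f := fun _ => G (ι x)) (μ := volume) (fun _ => M)
    (Eventually.of_forall fun n => (hFm.comp ((measurable_real_toNNReal.comp
      (measurable_const_mul (1 / ((n : ℝ) + 1)))).prodMk
        (measurable_const (a := x)))).aestronglyMeasurable)
    (Eventually.of_forall fun n => Eventually.of_forall fun s _ =>
      abs_integral_le_of_bound _ fun z => hM _)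
    intervalIntegrable_const
    (Eventually.of_forall fun s _ => by
      have hlim : Tendsto (fun n : ℕ => (1 / ((n : ℝ) + 1) * s).toNNReal) atTop (𝓝 0) := by
        have := (tendsto_one_div_add_atTop_nhds_zero_nat (𝕜 := ℝ)).mul_const s
        rw [zero_mul] at this
        simpa [Function.comp_def] using (continuous_real_toNNReal.tendsto 0).comp this
      have := (hκ.right_continuous G ⟨M, hM⟩ x 0).tendsto.comp
        (tendsto_nhdsWithin_iff.2 ⟨hlim, Eventually.of_forall fun n => Set.mem_Ici.2 zero_le⟩)
      rwa [h0] at this)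
  rwa [h1] at h2

variable [T2Space X]

/-- The short-time moment bound is iterated by Chapman–Kolmogorov over steps of length at most `ε`,
at the cost of one factor `max C 0` per step. -/
theorem lintegral_le (hκ : IsWeightedFellerKernels ψ ι κ) (t : ℝ≥0) :
    ∃ c : ℝ, 0 ≤ c ∧ ∀ x,
      ∫⁻ z, ENNReal.ofReal (ψ z) ∂κ t x ≤ ENNReal.ofReal c * ENNReal.ofReal (ψ x) := by
  obtain ⟨C, ε, hε, hC⟩ := hκ.moment
  have hm : Measurable fun z => ENNReal.ofReal (ψ z) := ψ.measurable.ennreal_ofReal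
  obtain ⟨n, hn⟩ := exists_nat_ge (t / ε)
  rw [div_le_iff₀ hε] at hn
  suffices H : ∀ n : ℕ, ∀ t : ℝ≥0, t ≤ n * ε → ∀ x, ∫⁻ z, ENNReal.ofReal (ψ z) ∂κ t x ≤
      ENNReal.ofReal (max C 0) ^ n * ENNReal.ofReal (ψ x) by
    refine ⟨max C 0 ^ n, by positivity, fun x => ?_⟩
    rw [ENNReal.ofReal_pow (le_max_right _ _)]
    exact H n t hn x
  intro n
  induction n with
  | zero =>
    intro t ht x
    have ht0 : t = 0 := by simpa using ht
    rw [ht0, hκ.zero, lintegral_dirac' _ hm, pow_zero, one_mul]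
  | succ n ih =>
    intro t ht x
    have hs : min t ε + (t - ε) = t := by
      rcases le_total t ε with h | h
      · rw [min_eq_left h, tsub_eq_zero_of_le h, add_zero]
      · rw [min_eq_right h, add_tsub_cancel_of_le h]
    have hr : t - ε ≤ n * ε := by
      rw [tsub_le_iff_right]
      calc t ≤ _ := ht
        _ = _ := by push_cast; ring
    rw [← hs, hκ.add, Kernel.lintegral_comp _ _ _ hm]
    calc ∫⁻ b, ∫⁻ z, ENNReal.ofReal (ψ z) ∂κ (t - ε) b ∂κ (min t ε) x
        ≤ ∫⁻ b, ENNReal.ofReal (max C 0) ^ n * ENNReal.ofReal (ψ b) ∂κ (min t ε) x :=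
          lintegral_mono fun b => ih _ hr b
      _ = ENNReal.ofReal (max C 0) ^ n * ∫⁻ b, ENNReal.ofReal (ψ b) ∂κ (min t ε) x :=
          lintegral_const_mul _ hm
      _ ≤ ENNReal.ofReal (max C 0) ^ n * (ENNReal.ofReal (max C 0) * ENNReal.ofReal (ψ x)) := by
          gcongr
          refine (hC _ (min_le_right _ _) x).trans ?_
          gcongr
          exact le_max_left _ _
      _ = _ := by rw [pow_succ, mul_assoc]

theorem integrable_weight (hκ : IsWeightedFellerKernels ψ ι κ) (t : ℝ≥0) (x : X) :
    Integrable ψ (κ t x) := by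
  obtain ⟨c, -, h⟩ := hκ.lintegral_le t
  refine ⟨ψ.measurable.aestronglyMeasurable, ?_⟩
  rw [hasFiniteIntegral_iff_ofReal (Eventually.of_forall fun z => (ψ.pos z).le)]
  exact (h x).trans_lt (ENNReal.mul_lt_top ENNReal.ofReal_lt_top ENNReal.ofReal_lt_top)

theorem integral_weight_le (hκ : IsWeightedFellerKernels ψ ι κ) {t : ℝ≥0} {x : X} {c : ℝ}
    (hc : 0 ≤ c) (h : ∫⁻ z, ENNReal.ofReal (ψ z) ∂κ t x ≤
      ENNReal.ofReal c * ENNReal.ofReal (ψ x)) : ∫ z, ψ z ∂κ t x ≤ c * ψ x := by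
  rw [← ENNReal.ofReal_mul hc, ← ofReal_integral_eq_lintegral_ofReal (hκ.integrable_weight t x)
    (Eventually.of_forall fun z => (ψ.pos z).le)] at h
  exact (ENNReal.ofReal_le_ofReal_iff (mul_nonneg hc (ψ.pos x).le)).1 h

theorem integrable (hκ : IsWeightedFellerKernels ψ ι κ) (f : GrowthControlled ψ) (t : ℝ≥0)
    (x : X) : Integrable (f : X → ℝ) (κ t x) :=
  ((hκ.integrable_weight t x).const_mul ‖f‖).mono' f.measurable.aestronglyMeasurable
    (Eventually.of_forall f.abs_apply_le)

theorem abs_integral_le (hκ : IsWeightedFellerKernels ψ ι κ) {f : X → ℝ} {a c : ℝ}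
    (ha : 0 ≤ a) (hf : ∀ z, |f z| ≤ a * ψ z) {t : ℝ≥0} {x : X}
    (hc : ∫ z, ψ z ∂κ t x ≤ c * ψ x) : |∫ z, f z ∂κ t x| ≤ a * c * ψ x := by
  calc |∫ z, f z ∂κ t x| ≤ ∫ z, a * ψ z ∂κ t x :=
        norm_integral_le_of_norm_le (f := f) ((hκ.integrable_weight t x).const_mul a)
          (Eventually.of_forall hf)
    _ = a * ∫ z, ψ z ∂κ t x := integral_const_mul _ _
    _ ≤ a * (c * ψ x) := mul_le_mul_of_nonneg_left hc ha
    _ = _ := (mul_assoc _ _ _).symm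

/-- The kernels act on `𝓑^ψ` by bounded linear operators. -/
theorem exists_operator (hκ : IsWeightedFellerKernels ψ ι κ) (hι : Continuous ι)
    (hinj : Function.Injective ι) (t : ℝ≥0) :
    ∃ T : GrowthControlled ψ →L[ℝ] GrowthControlled ψ, ∀ f x, T f x = ∫ z, f z ∂κ t x := by
  have := hκ.isMarkovKernel t
  obtain ⟨c, hc0, hc⟩ := hκ.lintegral_le t
  replace hc := fun x => hκ.integral_weight_le hc0 (hc x)
  have hbd : ∀ (f : GrowthControlled ψ) (x : X), |∫ z, f z ∂κ t x| ≤ ‖f‖ * c * ψ x := fun f x =>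
    hκ.abs_integral_le (norm_nonneg f) f.abs_apply_le (hc x)
  have hmem : ∀ f : GrowthControlled ψ,
      WeightedBounded.ofBound ψ (fun x => ∫ z, f z ∂κ t x) _ (hbd f) ∈
        (boundedContinuousSubmodule ψ).topologicalClosure := by
    intro f
    refine GrowthControlled.mem_of_approx hι fun η hη => ?_
    have hη' : 0 < η / (2 * (c + 1)) := by positivity
    obtain ⟨G, ⟨M, hM⟩, hG⟩ := GrowthControlled.exists_cylinder hι hinj f hη'
    obtain ⟨G', hG'b, hG'⟩ := exists_cylinder_approx (ψ := ψ) hι hinj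
      (h := fun x => ∫ z, G (ι z) ∂κ t x) (M := M)
      -- The hypotheses give sequential continuity only; metrizability of the sublevel sets makes
      -- that enough.
      (fun R hR => continuousOn_of_seq hι hinj (ψ.isCompact_sublevel R hR)
        (hκ.tendsto G ⟨M, hM⟩ t)) (fun x => abs_integral_le_of_bound _ fun z => hM _) (half_pos hη)
    refine ⟨G', hG'b, fun x => ?_⟩
    rw [WeightedBounded.ofBound_apply]
    have h1 : |∫ z, (f z - G (ι z)) ∂κ t x| ≤ η / (2 * (c + 1)) * c * ψ x :=
      hκ.abs_integral_le hη'.le hG (hc x)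
    rw [integral_sub (hκ.integrable f t x) (hκ.integrable_cylinder hι hM t x)] at h1
    have h2 : η / (2 * (c + 1)) * c ≤ η / 2 := by
      rw [div_mul_eq_mul_div, div_le_div_iff₀ (by positivity) (by positivity)]
      nlinarith
    have h3 := mul_le_mul_of_nonneg_right h2 (ψ.pos x).le
    have h4 := abs_sub_le (∫ z, f z ∂κ t x) (∫ z, G (ι z) ∂κ t x) (G' (ι x))
    linarith [hG' x]
  refine ⟨LinearMap.mkContinuous
    { toFun := fun f => ⟨_, hmem f⟩
      map_add' := fun f g => ?_
      map_smul' := fun a f => ?_ } c fun f => ?_, fun f x => rfl⟩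
  · refine Subtype.ext (Subtype.ext (funext fun x => ?_))
    exact integral_add (hκ.integrable f t x) (hκ.integrable g t x)
  · refine Subtype.ext (Subtype.ext (funext fun x => ?_))
    exact integral_const_mul _ _
  · rw [mul_comm]
    exact WeightedBounded.norm_le (by positivity) (hbd f)

/-! ### Operator bounds, strong continuity and the semigroup properties. -/

variable {T : ℝ≥0 → (GrowthControlled ψ →L[ℝ] GrowthControlled ψ)}

theorem exists_norm_operator_le (hκ : IsWeightedFellerKernels ψ ι κ)
    (hT : ∀ t f x, T t f x = ∫ z, f z ∂κ t x) :
    ∃ c : ℝ, ∃ ε : ℝ≥0, 0 < ε ∧ ∀ t ≤ ε, ‖T t‖ ≤ c := by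
  obtain ⟨C, ε, hε, hC⟩ := hκ.moment
  refine ⟨max C 0, ε, hε, fun t ht => ContinuousLinearMap.opNorm_le_bound _ (le_max_right _ _)
    fun f => ?_⟩
  refine GrowthControlled.norm_le (by positivity) fun x => ?_
  rw [hT, mul_comm (max C 0)]
  refine hκ.abs_integral_le (norm_nonneg f) f.abs_apply_le
    (hκ.integral_weight_le (le_max_right _ _) ((hC t ht x).trans ?_))
  gcongr
  exact le_max_left _ _

/-- Time averages of the orbit of a cylinder function are strongly continuous vectors. -/
theorem exists_average (hκ : IsWeightedFellerKernels ψ ι κ) (hι : Continuous ι)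
    (hinj : Function.Injective ι) (hT : ∀ t f x, T t f x = ∫ z, f z ∂κ t x)
    {G : C(ℕ → ℝ, ℝ)} {M : ℝ} (hM : ∀ z, |G z| ≤ M) {h : ℝ} (hh : 0 < h) :
    ∃ g : GrowthControlled ψ, Tendsto (fun t => ‖T t g - g‖) (𝓝[>] 0) (𝓝 0) ∧
      (∀ x, |g x| ≤ M) ∧ (∀ R : ℝ, 0 < R → ContinuousOn (g : X → ℝ) {x | ψ x ≤ R}) ∧
      ∀ x, g x = ∫ s in (0 : ℝ)..1, ∫ z, G (ι z) ∂κ (h * s).toNNReal x := by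
  have hmk := hκ.isMarkovKernel
  set F : ℝ≥0 → X → ℝ := fun s x => ∫ z, G (ι z) ∂κ s x with hF
  have hFM : ∀ s x, |F s x| ≤ M := fun s x => abs_integral_le_of_bound _ fun z => hM _
  have hFm : Measurable (Function.uncurry F) := hκ.measurable_integral_cylinder hι hM
  have hFx : ∀ x, Measurable fun r : ℝ => F r.toNNReal x := fun x =>
    hFm.comp (measurable_real_toNNReal.prodMk measurable_const)
  let A : X → ℝ := fun x => ∫ s in (0 : ℝ)..1, F (h * s).toNNReal x
  have hAM : ∀ x, |A x| ≤ M := fun x => by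
    simpa using intervalIntegral.norm_integral_le_of_norm_le_const (a := 0) (b := 1)
      (f := fun s => F (h * s).toNNReal x) (C := M) fun r _ => hFM _ _
  have hAc : ∀ R : ℝ, 0 < R → ContinuousOn A {x | ψ x ≤ R} := fun R hR =>
    continuousOn_of_seq hι hinj (ψ.isCompact_sublevel R hR) fun u x hu => by
      refine intervalIntegral.tendsto_integral_filter_of_dominated_convergence (fun _ => M)
        (Eventually.of_forall fun n => ?_)
        (Eventually.of_forall fun n => Eventually.of_forall fun s _ => hFM _ _)
        intervalIntegrable_const
        (Eventually.of_forall fun s _ => hκ.tendsto G ⟨M, hM⟩ _ u x hu)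
      exact ((hFx (u n)).comp (measurable_const_mul h)).aestronglyMeasurable
  obtain ⟨g, hg⟩ := GrowthControlled.exists_of_bounded hι hinj hAc hAM
  have hgA : (g : X → ℝ) = A := funext hg
  refine ⟨g, ?_, fun x => by rw [hg]; exact hAM x, fun R hR => by rw [hgA]; exact hAc R hR, hg⟩
  -- Fubini and Chapman–Kolmogorov: applying `T t` to the average just shifts its time window by
  -- `t`.
  have hTg : ∀ (t : ℝ≥0) x, T t g x = ∫ s in (0 : ℝ)..1, F (h * s + t).toNNReal x := by
    intro t x
    rw [hT, hgA]
    simp only [A]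
    have hjoint : Measurable fun p : X × ℝ => F (h * p.2).toNNReal p.1 :=
      hFm.comp ((measurable_real_toNNReal.comp (measurable_snd.const_mul h)).prodMk measurable_fst)
    simp_rw [intervalIntegral.integral_of_le (zero_le_one (α := ℝ))]
    rw [integral_integral_swap (Integrable.of_bound hjoint.aestronglyMeasurable M
      (Eventually.of_forall fun p => hFM _ _))]
    refine setIntegral_congr_fun measurableSet_Ioc fun s hs => ?_
    have hs0 : 0 ≤ h * s := mul_nonneg hh.le hs.1.le
    simp only [hF]
    have ht : (h * s + t).toNNReal = t + (h * s).toNNReal := by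
      rw [Real.toNNReal_add hs0 t.coe_nonneg, Real.toNNReal_coe, add_comm]
    rw [ht, hκ.add, Kernel.integral_comp]
    rw [← hκ.add]
    exact hκ.integrable_cylinder hι hM _ x
  obtain ⟨c, hc0, hc⟩ := exists_le_mul_weight ψ (h⁻¹ * (2 * M))
  have hbound : ∀ t : ℝ≥0, ‖T t g - g‖ ≤ c * t := fun t => by
    refine GrowthControlled.norm_le (by positivity) fun x => ?_
    have h1 := abs_average_shift_sub_le (hFx x) (fun r => hFM _ _) hh t.2
    have h2 : |T t g x - g x| ≤ h⁻¹ * (2 * M) * t := by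
      rw [hTg, hg]
      exact h1
    refine h2.trans ?_
    rw [mul_right_comm c]
    exact mul_le_mul_of_nonneg_right (hc x) t.2
  refine squeeze_zero (fun t => norm_nonneg _) hbound ?_
  have : Tendsto (fun t : ℝ≥0 => c * (t : ℝ)) (𝓝 0) (𝓝 (c * ((0 : ℝ≥0) : ℝ))) :=
    (continuous_const.mul NNReal.continuous_coe).tendsto 0
  rw [NNReal.coe_zero, mul_zero] at this
  exact this.mono_left nhdsWithin_le_nhds

/-- The semigroup of operators on `𝓑^ψ` is strongly continuous. -/
theorem strongly_continuous (hκ : IsWeightedFellerKernels ψ ι κ) (hι : Continuous ι)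
    (hinj : Function.Injective ι) (hT : ∀ t f x, T t f x = ∫ z, f z ∂κ t x)
    (f : GrowthControlled ψ) : Tendsto (fun t => ‖T t f - f‖) (𝓝[>] 0) (𝓝 0) := by
  have hb := hκ.exists_norm_operator_le hT
  obtain ⟨δ, hδ, hψδ⟩ := ψ.exists_pos_le
  refine tendsto_norm_sub_of_approx hb fun η hη => ?_
  obtain ⟨G, ⟨M, hM⟩, hG⟩ := GrowthControlled.exists_cylinder hι hinj f (half_pos hη)
  have hM0 : 0 ≤ M := (abs_nonneg _).trans (hM 0)
  choose g hgs hgM hgc hgA using fun n : ℕ =>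
    hκ.exists_average hι hinj hT hM (Nat.one_div_pos_of_nat (α := ℝ) (n := n))
  set R : ℝ := 2 * M / (η / 2) + 1
  have hR : 0 < R := by positivity
  have := isCompact_iff_compactSpace.1 (ψ.isCompact_sublevel R hR)
  -- The global bound `M` is built into `S` because uniform approximation controls `k` only on the
  -- sublevel set; outside it, `|k| ≤ M` and the choice of `R` suffice.
  let S : Set ({x | ψ x ≤ R} → ℝ) := {h | Continuous h ∧ ∃ k : GrowthControlled ψ,
    Tendsto (fun t => ‖T t k - k‖) (𝓝[>] 0) (𝓝 0) ∧ (∀ x, |k x| ≤ M) ∧ ∀ x, h x = k x}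
  have hS : Convex ℝ S := by
    rintro h ⟨hh, k, hk, hkM, hhk⟩ h' ⟨hh', k', hk', hkM', hhk'⟩ a b ha hb hab
    refine ⟨(hh.const_smul a).add (hh'.const_smul b), a • k + b • k', ?_, fun x => ?_, fun x => ?_⟩
    · refine squeeze_zero (fun t => norm_nonneg _) (fun t => ?_)
        (by simpa using (hk.const_mul a).add (hk'.const_mul b))
      have : T t (a • k + b • k') - (a • k + b • k') = a • (T t k - k) + b • (T t k' - k') := by
        rw [map_add, map_smul, map_smul, smul_sub, smul_sub]; abel
      rw [this]
      refine (norm_add_le _ _).trans_eq ?_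
      rw [norm_smul, norm_smul, Real.norm_of_nonneg ha, Real.norm_of_nonneg hb]
      rfl
    · have h1 : |a * k x + b * k' x| ≤ a * |k x| + b * |k' x| := by
        refine (abs_add_le _ _).trans_eq ?_
        rw [abs_mul, abs_mul, abs_of_nonneg ha, abs_of_nonneg hb]
      refine h1.trans ?_
      calc a * |k x| + b * |k' x| ≤ a * M + b * M :=
            add_le_add (mul_le_mul_of_nonneg_left (hkM x) ha)
              (mul_le_mul_of_nonneg_left (hkM' x) hb)
        _ = M := by rw [← add_mul, hab, one_mul]
    · change a * h x + b * h' x = a * k x + b * k' x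
      rw [hhk, hhk']
  obtain ⟨h, ⟨-, k, hks, hkM, hhk⟩, hkG⟩ := exists_uniform_approx_of_pointwise hS
    (fun h hh => hh.1) (g := fun n x => g n x)
    (fun n => ⟨(hgc n R hR).domRestrict, g n, hgs n, hgM n, fun x => rfl⟩)
    (fun n x => hgM n x) (f := fun x => G (ι x)) (G.continuous.comp (hι.comp continuous_subtype_val))
    (fun x => by simpa only [hgA] using hκ.tendsto_average hι hM x.1)
    -- The lower bound `δ ≤ ψ` turns this unweighted error into `η / 2 * ψ`.
    (δ := η / 2 * δ) (by positivity)
  refine ⟨k, GrowthControlled.norm_le hη.le fun x => ?_, hks⟩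
  have h1 : |k x - G (ι x)| ≤ η / 2 * ψ x := by
    by_cases hx : ψ x ≤ R
    · have := hkG ⟨x, hx⟩
      rw [hhk] at this
      exact this.trans (mul_le_mul_of_nonneg_left (hψδ x) (by positivity))
    · have h1 : 2 * M / (η / 2) * (η / 2) = 2 * M := div_mul_cancel₀ _ (by positivity)
      have h2 := abs_sub (k x) (G (ι x))
      have h3 := mul_le_mul_of_nonneg_left (not_le.1 hx).le (half_pos hη).le
      simp only [R] at h3
      linarith [hM (ι x), hkM x]
  change |k x - f x| ≤ _
  have h2 := abs_sub_le (k x) (G (ι x)) (f x)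
  rw [abs_sub_comm (G (ι x)) (f x)] at h2
  linarith [hG x]

/-- The operators on `𝓑^ψ` form a generalised Feller semigroup. -/
theorem isGeneralisedFellerSemigroup (hκ : IsWeightedFellerKernels ψ ι κ) (hι : Continuous ι)
    (hinj : Function.Injective ι) (hT : ∀ t f x, T t f x = ∫ z, f z ∂κ t x) :
    IsGeneralisedFellerSemigroup T where
  zero := by
    refine ContinuousLinearMap.ext fun f => Subtype.ext (Subtype.ext (funext fun x => ?_))
    refine (hT 0 f x).trans ?_
    rw [hκ.zero]
    exact integral_dirac' _ _ f.measurable.stronglyMeasurable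
  add t s := by
    refine ContinuousLinearMap.ext fun f => Subtype.ext (Subtype.ext (funext fun x => ?_))
    refine (hT (t + s) f x).trans ?_
    rw [hκ.add, Kernel.integral_comp (by rw [← hκ.add]; exact hκ.integrable f _ x)]
    refine Eq.trans ?_ (hT t (T s f) x).symm
    simp only [hT]
  pointwise f x := by
    rw [tendsto_iff_norm_sub_tendsto_zero]
    have h0 := (hκ.strongly_continuous hι hinj hT f).mul_const (ψ x)
    rw [zero_mul] at h0
    exact squeeze_zero (fun t => norm_nonneg _)
      (fun t => (T t f - f).abs_apply_le x) h0
  bounded := hκ.exists_norm_operator_le hT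
  positive t f hf x := by
    rw [hT]
    exact integral_nonneg hf

end IsWeightedFellerKernels

end KernelSemigroup

/-! ### Transition kernels of the Markov process. -/

section MarkovProcess

variable {Ω : Type*} {m : MeasurableSpace Ω} {X : Type*} [MeasurableSpace X]
  {P : Measure Ω} {𝓕 : Filtration ℝ≥0 m} {x : ℝ≥0 → X → Ω → X}

namespace IsTimeHomogeneousMarkov

theorem measurable (h : IsTimeHomogeneousMarkov 𝓕 P x) (t : ℝ≥0) (x₀ : X) :
    Measurable (x t x₀) :=
  (h.adapted x₀ t).mono (𝓕.le t) le_rfl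

/-- The transition kernel of a time homogeneous Markov process. -/
noncomputable def kernel [IsProbabilityMeasure P] (h : IsTimeHomogeneousMarkov 𝓕 P x) (t : ℝ≥0) :
    Kernel X X where
  toFun x₀ := P.map (x t x₀)
  measurable' := by
    refine Measure.measurable_of_measurable_coe _ fun A hA => ?_
    simp_rw [Measure.map_apply (h.measurable t _) hA]
    exact h.measurable_transition t A hA

variable [IsProbabilityMeasure P]

theorem kernel_apply (h : IsTimeHomogeneousMarkov 𝓕 P x) (t : ℝ≥0) (x₀ : X) :
    h.kernel t x₀ = P.map (x t x₀) := rfl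

theorem isMarkovKernel (h : IsTimeHomogeneousMarkov 𝓕 P x) (t : ℝ≥0) :
    IsMarkovKernel (h.kernel t) :=
  ⟨fun x₀ => Measure.isProbabilityMeasure_map (h.measurable t x₀).aemeasurable⟩

theorem kernel_zero (h : IsTimeHomogeneousMarkov 𝓕 P x) (x₀ : X) :
    h.kernel 0 x₀ = Measure.dirac x₀ := by
  rw [kernel_apply, Measure.map_congr (h.start x₀), Measure.map_const, measure_univ, one_smul]

/-- The Chapman–Kolmogorov equation. -/
theorem kernel_add (h : IsTimeHomogeneousMarkov 𝓕 P x) (s t : ℝ≥0) :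
    h.kernel (s + t) = h.kernel t ∘ₖ h.kernel s := by
  ext x₀ A hA
  have := h.isMarkovKernel t
  rw [Kernel.comp_apply' _ _ _ hA, kernel_apply, kernel_apply,
    lintegral_map ((h.kernel t).measurable_coe hA) (h.measurable s x₀),
    Measure.map_apply (h.measurable _ x₀) hA]
  have h1 := integral_condExp (μ := P) (𝓕.le s)
    (f := (x (s + t) x₀ ⁻¹' A).indicator fun _ => (1 : ℝ))
  -- The expectation of the Markov property, by the tower rule.
  have h2 : ∫ ω, P.real {ω' | x t (x s x₀ ω) ω' ∈ A} ∂P = P.real (x (s + t) x₀ ⁻¹' A) := by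
    rw [← integral_congr_ae (h.markov x₀ s t A hA)]
    refine h1.trans ?_
    rw [integral_indicator_const _ (h.measurable _ x₀ hA), smul_eq_mul, mul_one]
  have h3 : ∀ ω, h.kernel t (x s x₀ ω) A = P {ω' | x t (x s x₀ ω) ω' ∈ A} := fun ω => by
    rw [kernel_apply, Measure.map_apply (h.measurable _ _) hA]; rfl
  simp_rw [h3]
  have hm : Measurable fun ω => P {ω' | x t (x s x₀ ω) ω' ∈ A} :=
    (h.measurable_transition t A hA).comp (h.measurable s x₀)
  simp only [Measure.real] at h2
  rw [integral_toReal hm.aemeasurable (Eventually.of_forall fun ω => measure_lt_top _ _)] at h2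
  refine ((ENNReal.toReal_eq_toReal_iff' ?_ (measure_ne_top _ _)).1 h2).symm
  exact ne_top_of_le_ne_top ENNReal.one_ne_top
    ((lintegral_mono fun ω => prob_le_one).trans_eq (by simp))

end IsTimeHomogeneousMarkov

end MarkovProcess

/-! ### Application to the dual space. -/

theorem mainTheorem6
    {Y : Type*} [NormedAddCommGroup Y] [NormedSpace ℝ Y] [CompleteSpace Y]
    [TopologicalSpace.SeparableSpace Y]
    -- the Borel sigma-algebra of the weak-* topology on the dual space of `Y`
    [MeasurableSpace (WeakDual ℝ Y)] [BorelSpace (WeakDual ℝ Y)]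
    -- a countable subset of `Y` that separates the points of the dual space
    (y : ℕ → Y) (hy : ∀ x₁ x₂ : WeakDual ℝ Y, (∀ j, x₁ (y j) = x₂ (y j)) → x₁ = x₂)
    (ψ : AdmissibleWeight (WeakDual ℝ Y))
    {Ω : Type*} {m : MeasurableSpace Ω} (P : Measure Ω) [IsProbabilityMeasure P]
    (𝓕 : Filtration ℝ≥0 m) (h𝓕 : UsualConditions 𝓕 P)
    (x : ℝ≥0 → WeakDual ℝ Y → Ω → WeakDual ℝ Y)
    (hMarkov : IsTimeHomogeneousMarkov 𝓕 P x)
    (hpaths : ∀ x₀ : WeakDual ℝ Y, ∀ᵐ ω ∂P, ∀ t : ℝ≥0,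
      ContinuousWithinAt (fun s => x s x₀ ω) (Set.Ici t) t)
    (C : ℝ) (ε : ℝ≥0) (hε : 0 < ε)
    (hψ : ∀ (x₀ : WeakDual ℝ Y) (t : ℝ≥0), t ≤ ε →
      ∫⁻ ω, ENNReal.ofReal (ψ (x t x₀ ω)) ∂P ≤ ENNReal.ofReal (C * ψ x₀))
    (hcont : ∀ t : ℝ≥0, 0 < t → ∀ (j : ℕ) (u : ℕ → WeakDual ℝ Y) (x₀ : WeakDual ℝ Y),
      Tendsto u atTop (𝓝 x₀) →
        ∀ᵐ ω ∂P, Tendsto (fun n => x t (u n) ω (y j)) atTop (𝓝 (x t x₀ ω (y j)))) :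
    ∃ T : ℝ≥0 → (GrowthControlled ψ →L[ℝ] GrowthControlled ψ),
      (∀ (t : ℝ≥0) (f : GrowthControlled ψ) (x₀ : WeakDual ℝ Y),
        Integrable (fun ω => f (x t x₀ ω)) P ∧ T t f x₀ = ∫ ω, f (x t x₀ ω) ∂P) ∧
      IsGeneralisedFellerSemigroup T ∧
      ∀ f : GrowthControlled ψ, Tendsto (fun t => ‖T t f - f‖) (𝓝[>] 0) (𝓝 0) := by
  let ι : WeakDual ℝ Y → ℕ → ℝ := fun z j => z (y j)
  have hι : Continuous ι := continuous_pi fun j => WeakDual.eval_continuous (y j)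
  have hinj : Function.Injective ι := fun z w h => hy z w fun j => congrFun h j
  have hmeas := hMarkov.measurable
  have hG : ∀ G : C(ℕ → ℝ, ℝ), StronglyMeasurable fun z => G (ι z) := fun G =>
    (G.continuous.comp hι).measurable.stronglyMeasurable
  have hint : ∀ (G : C(ℕ → ℝ, ℝ)) (t : ℝ≥0) (x₀ : WeakDual ℝ Y),
      ∫ z, G (ι z) ∂hMarkov.kernel t x₀ = ∫ ω, G (ι (x t x₀ ω)) ∂P := fun G t x₀ =>
    integral_map (hmeas t x₀).aemeasurable (hG G).aestronglyMeasurable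
  have hGω : ∀ (G : C(ℕ → ℝ, ℝ)) (t : ℝ≥0) (x₀ : WeakDual ℝ Y),
      AEStronglyMeasurable (fun ω => G (ι (x t x₀ ω))) P := fun G t x₀ =>
    ((hG G).comp_measurable (hmeas t x₀)).aestronglyMeasurable
  have hκ : IsWeightedFellerKernels ψ ι hMarkov.kernel :=
    { isMarkovKernel := hMarkov.isMarkovKernel
      zero := hMarkov.kernel_zero
      add := hMarkov.kernel_add
      moment := by
        refine ⟨C, ε, hε, fun t ht x₀ => ?_⟩
        rw [← ENNReal.ofReal_mul' (ψ.pos x₀).le, hMarkov.kernel_apply,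
          lintegral_map ψ.measurable.ennreal_ofReal (hmeas t x₀)]
        exact hψ x₀ t ht
      tendsto := by
        rintro G ⟨M, hM⟩ t u x₀ hu
        -- At time `0` the process hypothesis says nothing, but the kernel is a Dirac mass.
        rcases eq_or_lt_of_le (zero_le (a := t)) with rfl | ht
        · simp_rw [hMarkov.kernel_zero, fun z => integral_dirac' _ z (hG G)]
          exact ((G.continuous.comp hι).tendsto x₀).comp hu
        · simp_rw [hint]
          refine tendsto_integral_of_dominated_convergence (fun _ => M) (fun n => hGω G t _)
            (integrable_const M) (fun n => Eventually.of_forall fun ω => hM _) ?_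
          -- Countability of the family `y` merges the exceptional null sets into one.
          filter_upwards [ae_all_iff.2 fun j => hcont t ht j u x₀ hu] with ω hω
          exact (G.continuous.tendsto _).comp (tendsto_pi_nhds.2 hω)
      right_continuous := by
        rintro G ⟨M, hM⟩ x₀ s
        simp_rw [hint]
        refine continuousWithinAt_of_dominated (bound := fun _ => M)
          (Eventually.of_forall fun t => hGω G t x₀)
          (Eventually.of_forall fun t => Eventually.of_forall fun ω => hM _) (integrable_const M) ?_
        filter_upwards [hpaths x₀] with ω hω
        exact (G.continuous.comp hι).continuousAt.comp_continuousWithinAt (hω s) }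
  choose T hT using hκ.exists_operator hι hinj
  refine ⟨T, fun t f x₀ => ⟨?_, ?_⟩, hκ.isGeneralisedFellerSemigroup hι hinj hT,
    hκ.strongly_continuous hι hinj hT⟩
  · exact (hκ.integrable f t x₀).comp_measurable (hmeas t x₀)
  · rw [hT]
    exact integral_map (hmeas t x₀).aemeasurable f.measurable.aestronglyMeasurable
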